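/- Let $V$ be a two-sided quaternionic Banach space, and let $T$ be the infinitesimal generator of a strongly continuous group $(\mathcal U_T(t))_{t\in\mathbb R}$ of bounded right linear operators on $V$, so that $T v=\lim_{h\to0^+}\frac1h(\mathcal U_T(h)v-v)$ with domain $\mathcal D(T)$ the set of all $v$ for which this limit exists. Let $M$ and $\omega\ge 0$ be real numbers such that $\|\mathcal U_T(t)\|\le Me^{\omega|t|}$ for all $t\in\mathbb R$. A function $f$ with quaternionic values belongs to $\mathbf V(T)$ if there are a quaternionic measure $\mu$ on the Borel sets of $\mathbb R$ and an $\varepsilon>0$ such that $\int_{\mathbb R}e^{(\omega+\varepsilon)|t|}\,d|\mu|(t)<\infty$, where $|\mu|$ is the total variation of $\mu$, and $$f(s)=\int_{\mathbb R}d\mu(t)\,e^{-st}\qquad\text{for all quaternions } s \text{ with } -(\omega+\varepsilon)<\mathrm{Re}(s)<\omega+\varepsilon .$$ For such $f$ and $\mu$ the operator $f(T)$ is defined by $f(T)v=\int_{\mathbb R}d\mu(t)\,\mathcal U_T(-t)v$, $v\in V$. Let $P(s)=\sum_{k=0}^m a_ks^k$ be a polynomial of degree $m$ with quaternionic coefficients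 that is intrinsic, i.e. $P(\overline s)=\overline{P(s)}$ for all quaternions $s$, and put $P[T]u=\sum_{k=0}^m a_kT^ku$ for $u\in\mathcal D(T^m)$. Suppose that $f$ and the pointwise product $Pf\colon s\mapsto P(s)f(s)$ both belong to $\mathbf V(T)$. Then $f(T)V\subseteq\mathcal D(T^m)$ and $$P[T]f(T)u=(Pf)(T)u\qquad\text{for all }u\in V,$$ whichever measures are used to represent $f$ and $Pf$. -/

import Mathlib

open Filter Topology MeasureTheory Quaternion Polynomial

namespace QuatCalc

/-! A two-sided quaternionic Banach space `V` is a real Banach space with commuting left and right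
`ℍ`-actions (`Module ℍ V` and `Module ℍᵐᵒᵖ V`) that extend the real scalar multiplication and
satisfy `‖a v‖ = |a| ‖v‖ = ‖v a‖`.  Right linear operators are the `ℍᵐᵒᵖ`-linear maps. -/

/-- A strongly continuous group of bounded right linear operators on `V`. -/
structure StronglyContinuousGroup (V : Type*) [NormedAddCommGroup V] [Module ℍ[ℝ]ᵐᵒᵖ V] where
  /-- The operator `U(t)`. -/
  op : ℝ → V →L[ℍ[ℝ]ᵐᵒᵖ] V
  op_zero : ∀ v, op 0 v = v
  op_add : ∀ s t v, op (s + t) v = op s (op t v)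
  continuous_op : ∀ v, Continuous fun t => op t v

/-- The infinitesimal generator `T` of the group `U`: its domain consists of the `v` for which
`lim_{h → 0+} h⁻¹ (U(h) v - v)` exists, and `T v` is that limit. -/
noncomputable def StronglyContinuousGroup.generator {V : Type*} [NormedAddCommGroup V]
    [NormedSpace ℝ V] [Module ℍ[ℝ]ᵐᵒᵖ V] [IsScalarTower ℝ ℍ[ℝ]ᵐᵒᵖ V] [NormSMulClass ℍ[ℝ]ᵐᵒᵖ V]
    (U : StronglyContinuousGroup V) : V →ₗ.[ℍ[ℝ]ᵐᵒᵖ] V :=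
  haveI hadd : ∀ {v v' w w' : V},
      Tendsto (fun h : ℝ => h⁻¹ • (U.op h v - v)) (𝓝[>] 0) (𝓝 w) →
      Tendsto (fun h : ℝ => h⁻¹ • (U.op h v' - v')) (𝓝[>] 0) (𝓝 w') →
      Tendsto (fun h : ℝ => h⁻¹ • (U.op h (v + v') - (v + v'))) (𝓝[>] 0) (𝓝 (w + w')) := by
    intro v v' w w' hv hv'
    refine (hv.add hv').congr fun h => ?_
    rw [← smul_add, map_add]
    congr 1
    abel
  haveI hsmul : ∀ (c : ℍ[ℝ]ᵐᵒᵖ) {v w : V},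
      Tendsto (fun h : ℝ => h⁻¹ • (U.op h v - v)) (𝓝[>] 0) (𝓝 w) →
      Tendsto (fun h : ℝ => h⁻¹ • (U.op h (c • v) - c • v)) (𝓝[>] 0) (𝓝 (c • w)) := by
    intro c v w hv
    refine (hv.const_smul c).congr fun h => ?_
    have : SMulCommClass ℍ[ℝ]ᵐᵒᵖ ℝ V := (IsScalarTower.to_smulCommClass (R := ℝ)).symm
    rw [map_smul, ← smul_sub, smul_comm c]
  { domain :=
      { carrier := {v | ∃ w, Tendsto (fun h : ℝ => h⁻¹ • (U.op h v - v)) (𝓝[>] 0) (𝓝 w)}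
        add_mem' := by
          rintro v v' ⟨w, hw⟩ ⟨w', hw'⟩
          exact ⟨w + w', hadd hw hw'⟩
        zero_mem' := ⟨0, by simp⟩
        smul_mem' := by
          rintro c v ⟨w, hw⟩
          exact ⟨c • w, hsmul c hw⟩ }
    toFun :=
      { toFun := fun v => v.2.choose
        map_add' := fun v v' => tendsto_nhds_unique (v + v').2.choose_spec
          (hadd v.2.choose_spec v'.2.choose_spec)
        map_smul' := fun c v => tendsto_nhds_unique (c • v).2.choose_spec
          (hsmul c v.2.choose_spec) } }

/-- The composition `g ∘ f` of partially defined operators, with its natural domain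
`{v ∈ D(f) | f v ∈ D(g)}`. -/
def pcomp {R V : Type*} [Ring R] [AddCommGroup V] [Module R V] (g f : V →ₗ.[R] V) :
    V →ₗ.[R] V where
  domain := (g.domain.comap f.toFun).map f.domain.subtype
  toFun :=
    { toFun := fun v => g ⟨f ⟨v, by obtain ⟨y, -, hy⟩ := v.2; exact hy ▸ y.2⟩, by
        obtain ⟨v, y, hy, rfl⟩ := v
        exact hy⟩
      map_add' := by
        intro v v'
        rw [← LinearPMap.map_add]
        congr 1
        ext
        exact LinearPMap.map_add f ⟨v, _⟩ ⟨v', _⟩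
      map_smul' := by
        intro c v
        rw [RingHom.id_apply, ← LinearPMap.map_smul]
        congr 1
        ext
        exact LinearPMap.map_smul f c ⟨v, _⟩ }

/-- The powers `T^n` with their natural domains: `T^0 = id` on all of `V`, `T^(n+1) = T ∘ T^n`. -/
def ppow {R V : Type*} [Ring R] [AddCommGroup V] [Module R V] (T : V →ₗ.[R] V) :
    ℕ → V →ₗ.[R] V
  | 0 => ⟨⊤, (⊤ : Submodule R V).subtype⟩
  | n + 1 => pcomp T (ppow T n)

theorem ppow_domain_antitone {R V : Type*} [Ring R] [AddCommGroup V] [Module R V]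
    (T : V →ₗ.[R] V) : Antitone fun n => (ppow T n).domain :=
  antitone_nat_of_succ_le fun n v hv => by
    obtain ⟨y, -, rfl⟩ := hv
    exact y.2

/-- `P[T] = ∑ aₖ T^k` for a quaternionic polynomial `P(s) = ∑ aₖ s^k` of degree `m`,
with domain `D(T^m)`. -/
noncomputable def polyOp {V : Type*} [AddCommGroup V] [Module ℍ[ℝ] V] [Module ℍ[ℝ]ᵐᵒᵖ V]
    [SMulCommClass ℍ[ℝ] ℍ[ℝ]ᵐᵒᵖ V] (P : ℍ[ℝ][X]) (T : V →ₗ.[ℍ[ℝ]ᵐᵒᵖ] V) :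
    V →ₗ.[ℍ[ℝ]ᵐᵒᵖ] V where
  domain := (ppow T P.natDegree).domain
  toFun :=
    haveI : SMulCommClass ℍ[ℝ]ᵐᵒᵖ ℍ[ℝ] V := SMulCommClass.symm _ _ _
    ∑ k : Fin (P.natDegree + 1), P.coeff k • ((ppow T k).toFun ∘ₗ
      Submodule.inclusion (ppow_domain_antitone T (Nat.lt_succ_iff.mp k.2)))

/-- A quaternionic polynomial `P(x) = ∑ aₖ x^k` is intrinsic if `P(x̄)` is the conjugate of `P(x)`
for every quaternion `x`. -/
def IsIntrinsic (P : ℍ[ℝ][X]) : Prop :=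
  ∀ x : ℍ[ℝ], P.eval (star x) = star (P.eval x)

/-- The integral `∫ dμ(t) F(t)` of a function with values in a left quaternionic Banach space
against a quaternionic measure, the values of the measure acting from the left. -/
noncomputable def leftIntegral {V : Type*} [NormedAddCommGroup V] [NormedSpace ℝ V]
    [Module ℍ[ℝ] V] [IsScalarTower ℝ ℍ[ℝ] V] [NormSMulClass ℍ[ℝ] V]
    (μ : VectorMeasure ℝ ℍ[ℝ]) (F : ℝ → V) : V :=
  μ.integral F (ContinuousLinearMap.lsmul ℝ ℍ[ℝ]).flip

/-- `f ∈ V(T)`, represented by `μ ∈ S(T)`: for some `ε > 0` the integral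
`∫ e^{(ω+ε)|t|} d|μ|(t)` is finite, where `|μ|` is the total variation of `μ`, and
`f(s) = ∫ dμ(t) e^{-st}` on the strip `-(ω+ε) < Re s < ω+ε`. -/
def IsLaplaceStieltjes (ω : ℝ) (μ : VectorMeasure ℝ ℍ[ℝ]) (f : ℍ[ℝ] → ℍ[ℝ]) : Prop :=
  ∃ ε > 0, ∫⁻ t, ENNReal.ofReal (Real.exp ((ω + ε) * |t|)) ∂μ.variation < ⊤ ∧
    ∀ s : ℍ[ℝ], -(ω + ε) < s.re → s.re < ω + ε →
      f s = leftIntegral μ fun t => NormedSpace.exp (-(t • s))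

/-- The operator `f(T) v = ∫ dμ(t) U(-t) v`, where `T` is the generator of the group `U` and `f` is
the Laplace-Stieltjes transform of `μ`. -/
noncomputable def funOp {V : Type*} [NormedAddCommGroup V] [NormedSpace ℝ V]
    [Module ℍ[ℝ] V] [IsScalarTower ℝ ℍ[ℝ] V] [NormSMulClass ℍ[ℝ] V] [Module ℍ[ℝ]ᵐᵒᵖ V]
    (U : StronglyContinuousGroup V) (μ : VectorMeasure ℝ ℍ[ℝ]) (v : V) : V :=
  leftIntegral μ fun t => U.op (-t) v

end QuatCalc

/-! Left multiplication by a quaternion need not commute with the right linear operator `T`, so the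
product rule cannot be proved one quaternionic coordinate at a time. What rescues it is that an
intrinsic `P` has real coefficients and that, for nonconstant `P`, the hypothesis on `Pf` forces `μ`
to be real. On a slice ℝ + ℝq with q² = -1 the transforms of `μ` and `ν` have the form ∑ eₙ
ι(φₙ(z)), and analytic continuation from the real axis lets P(z) be pulled out of the transform of
`ν` on the right. Since `Pf` has P(z) on the left, f commutes with q wherever P(z) is not real,
hence by continuity on the real axis. Taking q = i and q = j makes f real there, and uniqueness of
the Laplace transform kills the imaginary coordinates of `μ` (`componentPair_fst_eq_snd`). For
constant `P` uniqueness alone suffices.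

For real measures, `exists_chain_of_laplace` is an induction on the degree. Write P = (X - l)Q +
P(l) with l large. Division of a transform by l - x is convolution with the resolvent measure, which
becomes the resolvent of `T` in the calculus. Thus Q[T]f(T)u is a resolvent value, lies in the
domain of `T`, and solving for the leading term gains one more power of `T`. -/

namespace QuatCalc

/-! ### Measures with exponential moments -/

/-- `∫ e^{a|t|} dσ(t) < ∞`. -/
def HasExpMoment (a : ℝ) (σ : Measure ℝ) : Prop :=
  Integrable (fun t => Real.exp (a * |t|)) σ

namespace HasExpMoment

variable {a : ℝ} {σ τ : Measure ℝ}

theorem mono_measure (hσ : HasExpMoment a σ) (h : τ ≤ σ) : HasExpMoment a τ :=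
  Integrable.mono_measure hσ h

theorem integrable {E : Type*} [NormedAddCommGroup E] (hσ : HasExpMoment a σ) {F : ℝ → E}
    (hF : Continuous F) {C b : ℝ} (hb : b ≤ a) (h : ∀ t, ‖F t‖ ≤ C * Real.exp (b * |t|)) :
    Integrable F σ := by
  refine (Integrable.const_mul hσ |C|).mono' hF.aestronglyMeasurable (ae_of_all _ fun t => ?_)
  refine (h t).trans (mul_le_mul (le_abs_self C) ?_ (Real.exp_pos _).le (abs_nonneg C))
  gcongr

theorem isFiniteMeasure (ha : 0 ≤ a) (hσ : HasExpMoment a σ) : IsFiniteMeasure σ := by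
  have h : Integrable (fun _ : ℝ => (1 : ℝ)) σ :=
    hσ.integrable continuous_const (C := 1) ha (by simp)
  rcases integrable_const_iff.1 h with h | h
  · norm_num at h
  · exact h

theorem integrable_exp_mul (hσ : HasExpMoment a σ) {x : ℝ} (hx : |x| ≤ a) :
    Integrable (fun t => Real.exp (x * t)) σ := by
  refine hσ.integrable (by fun_prop) (C := 1) hx fun t => ?_
  rw [one_mul, Real.norm_eq_abs, Real.abs_exp, Real.exp_le_exp, ← abs_mul]
  exact le_abs_self _

theorem add (hσ : HasExpMoment a σ) (hτ : HasExpMoment a τ) : HasExpMoment a (σ + τ) :=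
  Integrable.add_measure hσ hτ

theorem smul (hσ : HasExpMoment a σ) {c : ENNReal} (hc : c ≠ ⊤) : HasExpMoment a (c • σ) :=
  Integrable.smul_measure hσ hc

/-- The weight is submultiplicative: e^{a|s+t|} ≤ e^{a|s|} e^{a|t|} for a ≥ 0. -/
theorem conv (ha : 0 ≤ a) (hσ : HasExpMoment a σ) (hτ : HasExpMoment a τ) :
    HasExpMoment a (σ ∗ τ) := by
  have := hσ.isFiniteMeasure ha
  have := hτ.isFiniteMeasure ha
  have key : Integrable (fun z : ℝ × ℝ => Real.exp (a * |z.1 + z.2|)) (σ.prod τ) := by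
    refine (Integrable.mul_prod hσ hτ).mono' (by fun_prop) (ae_of_all _ fun z => ?_)
    rw [Real.norm_eq_abs, Real.abs_exp, ← Real.exp_add, Real.exp_le_exp, ← mul_add]
    exact mul_le_mul_of_nonneg_left (abs_add_le _ _) ha
  unfold HasExpMoment Measure.conv
  rw [integrable_map_measure (by fun_prop) (by fun_prop)]
  exact key

theorem mem_interior_integrableExpSet (hσ : HasExpMoment a σ) {x : ℝ} (hx : |x| < a) :
    x ∈ interior (ProbabilityTheory.integrableExpSet id σ) := by
  rw [mem_interior]
  refine ⟨Set.Ioo (-a) a, fun y hy => ?_, isOpen_Ioo, abs_lt.1 hx⟩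
  exact hσ.integrable_exp_mul (abs_lt.2 hy).le

end HasExpMoment

/-! ### Uniqueness of the Laplace transform -/

/-- The identity theorem on a vertical strip. -/
theorem eqOn_strip_of_eq_real {a : ℝ} {φ ψ : ℂ → ℂ} (ha : 0 < a)
    (hφ : ∀ z : ℂ, |z.re| < a → AnalyticAt ℂ φ z) (hψ : ∀ z : ℂ, |z.re| < a → AnalyticAt ℂ ψ z)
    (h : ∀ x : ℝ, |x| < a → φ x = ψ x) : ∀ z : ℂ, |z.re| < a → φ z = ψ z := by
  have hconv : Convex ℝ {z : ℂ | |z.re| < a} := by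
    have : {z : ℂ | |z.re| < a} = Complex.reLm ⁻¹' Set.Ioo (-a) a := by
      ext z; simp [abs_lt]
    rw [this]
    exact (convex_Ioo _ _).linear_preimage _
  refine AnalyticOnNhd.eqOn_of_preconnected_of_frequently_eq (𝕜 := ℂ) (f := φ) (g := ψ)
    (U := {z : ℂ | |z.re| < a}) hφ hψ hconv.isPreconnected (z₀ := 0) (by simpa using ha) ?_
  -- The real points of the strip accumulate at 0, which is all the identity theorem asks for.
  have hfreq : ∃ᶠ x : ℝ in 𝓝[≠] 0, |x| < a := by
    refine Eventually.frequently (mem_nhdsWithin_of_mem_nhds ?_)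
    exact (isOpen_lt continuous_abs continuous_const).mem_nhds (by simpa using ha)
  have hto : Tendsto (fun x : ℝ => (x : ℂ)) (𝓝[≠] 0) (𝓝[≠] 0) := by
    refine tendsto_nhdsWithin_iff.2 ⟨?_, ?_⟩
    · exact (Complex.continuous_ofReal.tendsto' 0 0 (by simp)).mono_left nhdsWithin_le_nhds
    · filter_upwards [self_mem_nhdsWithin] with x hx
      simpa using hx
  exact hto.frequently (hfreq.mono h)

/-- Measures whose Laplace transforms agree on a symmetric interval are equal. -/
theorem ext_of_laplace_eq {a : ℝ} {σ τ : Measure ℝ} (ha : 0 < a) (hσ : HasExpMoment a σ)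
    (hτ : HasExpMoment a τ)
    (h : ∀ x : ℝ, |x| < a → ∫ t, Real.exp (-(t * x)) ∂σ = ∫ t, Real.exp (-(t * x)) ∂τ) :
    σ = τ := by
  have := hσ.isFiniteMeasure ha.le
  have := hτ.isFiniteMeasure ha.le
  have key : ∀ z : ℂ, |z.re| < a →
      ProbabilityTheory.complexMGF id σ z = ProbabilityTheory.complexMGF id τ z := by
    refine eqOn_strip_of_eq_real ha
      (fun z hz => ProbabilityTheory.analyticAt_complexMGF (hσ.mem_interior_integrableExpSet hz))
      (fun z hz => ProbabilityTheory.analyticAt_complexMGF (hτ.mem_interior_integrableExpSet hz))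
      fun x hx => ?_
    rw [ProbabilityTheory.complexMGF_ofReal, ProbabilityTheory.complexMGF_ofReal]
    have := h (-x) (by rwa [abs_neg])
    simp only [mul_neg, neg_neg] at this
    simpa [ProbabilityTheory.mgf, mul_comm] using this
  -- The characteristic function is the transform on the imaginary axis, which lies inside the
  -- strip.
  refine Measure.ext_of_charFun (funext fun t => ?_)
  rw [← ProbabilityTheory.complexMGF_id_mul_I, ← ProbabilityTheory.complexMGF_id_mul_I]
  exact key _ (by simpa using ha)

/-! ### Differences of measures -/

/-- The integral against the difference of two measures. -/
noncomputable def diffIntegral {E : Type*} [NormedAddCommGroup E] [NormedSpace ℝ E]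
    (p : Measure ℝ × Measure ℝ) (F : ℝ → E) : E :=
  ∫ t, F t ∂p.1 - ∫ t, F t ∂p.2

/-- `p - c q` as a difference of measures. -/
noncomputable def diffSubSMul (p : Measure ℝ × Measure ℝ) (c : ℝ) (q : Measure ℝ × Measure ℝ) :
    Measure ℝ × Measure ℝ :=
  (p.1 + (ENNReal.ofReal c • q.2 + ENNReal.ofReal (-c) • q.1),
    p.2 + (ENNReal.ofReal c • q.1 + ENNReal.ofReal (-c) • q.2))

theorem diffIntegral_diffSubSMul {E : Type*} [NormedAddCommGroup E] [NormedSpace ℝ E]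
    (p q : Measure ℝ × Measure ℝ) (c : ℝ) {F : ℝ → E} (hp₁ : Integrable F p.1)
    (hp₂ : Integrable F p.2) (hq₁ : Integrable F q.1) (hq₂ : Integrable F q.2) :
    diffIntegral (diffSubSMul p c q) F = diffIntegral p F - c • diffIntegral q F := by
  have hs : ∀ {σ : Measure ℝ} (r : ℝ), Integrable F σ → Integrable F (ENNReal.ofReal r • σ) :=
    fun r h => h.smul_measure ENNReal.ofReal_ne_top
  have hc : c = max c 0 - max (-c) 0 := by
    rcases le_total 0 c with h | h <;> simp [h]
  simp only [diffIntegral, diffSubSMul]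
  rw [integral_add_measure hp₁ ((hs _ hq₂).add_measure (hs _ hq₁)),
    integral_add_measure hp₂ ((hs _ hq₁).add_measure (hs _ hq₂)),
    integral_add_measure (hs _ hq₂) (hs _ hq₁), integral_add_measure (hs _ hq₁) (hs _ hq₂)]
  simp only [integral_smul_measure, ENNReal.toReal_ofReal']
  conv_rhs => rw [hc]
  module

theorem HasExpMoment.diffSubSMul {a c : ℝ} {p q : Measure ℝ × Measure ℝ}
    (hp : HasExpMoment a p.1 ∧ HasExpMoment a p.2) (hq : HasExpMoment a q.1 ∧ HasExpMoment a q.2) :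
    HasExpMoment a (diffSubSMul p c q).1 ∧ HasExpMoment a (diffSubSMul p c q).2 :=
  ⟨hp.1.add ((hq.2.smul ENNReal.ofReal_ne_top).add (hq.1.smul ENNReal.ofReal_ne_top)),
    hp.2.add ((hq.1.smul ENNReal.ofReal_ne_top).add (hq.2.smul ENNReal.ofReal_ne_top))⟩

theorem norm_exp_neg_mul_le (x t : ℝ) : ‖Real.exp (-(t * x))‖ ≤ 1 * Real.exp (|x| * |t|) := by
  rw [one_mul, Real.norm_eq_abs, Real.abs_exp, Real.exp_le_exp, ← abs_mul, mul_comm t]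
  exact neg_le_abs _

/-- If the Laplace transform of a difference of measures vanishes then the measures are equal. -/
theorem fst_eq_snd_of_laplace_eq_zero {a : ℝ} {p : Measure ℝ × Measure ℝ} (ha : 0 < a)
    (hp : HasExpMoment a p.1 ∧ HasExpMoment a p.2)
    (h : ∀ x : ℝ, |x| < a → diffIntegral p (fun t => Real.exp (-(t * x))) = 0) : p.1 = p.2 :=
  ext_of_laplace_eq ha hp.1 hp.2 fun x hx => sub_eq_zero.1 (h x hx)

/-- A proportionality of Laplace transforms carries over to all integrals. -/
theorem diffIntegral_eq_smul_of_laplace {E : Type*} [NormedAddCommGroup E] [NormedSpace ℝ E]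
    {a c : ℝ} {p q : Measure ℝ × Measure ℝ} (ha : 0 < a)
    (hp : HasExpMoment a p.1 ∧ HasExpMoment a p.2) (hq : HasExpMoment a q.1 ∧ HasExpMoment a q.2)
    (h : ∀ x : ℝ, |x| < a → c * diffIntegral q (fun t => Real.exp (-(t * x))) =
      diffIntegral p (fun t => Real.exp (-(t * x))))
    {F : ℝ → E} (hF : Continuous F) {C b : ℝ} (hb : b ≤ a)
    (hFb : ∀ t, ‖F t‖ ≤ C * Real.exp (b * |t|)) :
    c • diffIntegral q F = diffIntegral p F := by
  -- The transform of p - c q vanishes, so its two halves agree as measures and every integral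
  -- against it is zero.
  have key : (diffSubSMul p c q).1 = (diffSubSMul p c q).2 := by
    refine fst_eq_snd_of_laplace_eq_zero ha (HasExpMoment.diffSubSMul hp hq) fun x hx => ?_
    have hi : ∀ {σ : Measure ℝ}, HasExpMoment a σ → Integrable (fun t => Real.exp (-(t * x))) σ :=
      fun hσ => hσ.integrable (by fun_prop) hx.le (norm_exp_neg_mul_le x)
    rw [diffIntegral_diffSubSMul p q c (hi hp.1) (hi hp.2) (hi hq.1) (hi hq.2), ← h x hx,
      smul_eq_mul, sub_self]
  have hi : ∀ {σ : Measure ℝ}, HasExpMoment a σ → Integrable F σ :=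
    fun hσ => hσ.integrable hF hb hFb
  have := diffIntegral_diffSubSMul p q c (hi hp.1) (hi hp.2) (hi hq.1) (hi hq.2)
  rw [diffIntegral, key, sub_self] at this
  exact (sub_eq_zero.1 this.symm).symm

/-! ### The resolvent measure -/

/-- The measure `e^{l t} dt` on the negative half-line. -/
noncomputable def resolventMeasure (l : ℝ) : Measure ℝ :=
  (volume.restrict (Set.Iic 0)).withDensity fun t => ((Real.exp (l * t)).toNNReal : ENNReal)

theorem integral_resolventMeasure {E : Type*} [NormedAddCommGroup E] [NormedSpace ℝ E] (l : ℝ)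
    (F : ℝ → E) : ∫ t, F t ∂resolventMeasure l = ∫ t in Set.Iic 0, Real.exp (l * t) • F t := by
  rw [resolventMeasure, integral_withDensity_eq_integral_smul (by fun_prop)]
  refine integral_congr_ae (ae_of_all _ fun t => ?_)
  simp [NNReal.smul_def, Real.coe_toNNReal _ (Real.exp_pos _).le]

theorem integrable_resolventMeasure_iff {E : Type*} [NormedAddCommGroup E] [NormedSpace ℝ E]
    {l : ℝ} {F : ℝ → E} : Integrable F (resolventMeasure l) ↔
      IntegrableOn (fun t => Real.exp (l * t) • F t) (Set.Iic 0) := by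
  rw [resolventMeasure, integrable_withDensity_iff_integrable_smul (by fun_prop), IntegrableOn]
  refine integrable_congr (ae_of_all _ fun t => ?_)
  simp [NNReal.smul_def, Real.coe_toNNReal _ (Real.exp_pos _).le]

theorem hasExpMoment_resolventMeasure {a l : ℝ} (h : a < l) :
    HasExpMoment a (resolventMeasure l) := by
  rw [HasExpMoment, integrable_resolventMeasure_iff]
  refine (integrableOn_exp_mul_Iic (sub_pos.2 h) 0).congr_fun (fun t ht => ?_) measurableSet_Iic
  rw [smul_eq_mul, ← Real.exp_add, abs_of_nonpos ht]
  ring_nf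

theorem laplace_resolventMeasure {l x : ℝ} (h : x < l) :
    ∫ t, Real.exp (-(t * x)) ∂resolventMeasure l = (l - x)⁻¹ := by
  rw [integral_resolventMeasure]
  have := integral_exp_mul_Iic (sub_pos.2 h) 0
  rw [mul_zero, Real.exp_zero, one_div] at this
  rw [← this]
  refine integral_congr_ae (ae_of_all _ fun t => ?_)
  simp only [smul_eq_mul, ← Real.exp_add]
  congr 1
  ring

/-- By Fubini the transform of a convolution is a product. This is how the factor X - l is divided
out at the level of measures. -/
theorem laplace_conv_resolventMeasure {a l x : ℝ} {σ : Measure ℝ} (ha : 0 ≤ a) (hl : a < l)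
    (hσ : HasExpMoment a σ) (hx : |x| < a) :
    ∫ t, Real.exp (-(t * x)) ∂(resolventMeasure l ∗ σ) =
      (l - x)⁻¹ * ∫ t, Real.exp (-(t * x)) ∂σ := by
  have hρ := hasExpMoment_resolventMeasure hl
  have := hσ.isFiniteMeasure ha
  have := hρ.isFiniteMeasure ha
  rw [integral_conv ((hρ.conv ha hσ).integrable (by fun_prop) hx.le (norm_exp_neg_mul_le x)),
    ← laplace_resolventMeasure ((le_abs_self x).trans_lt (hx.trans hl)), ← integral_mul_const]
  refine integral_congr_ae (ae_of_all _ fun s => ?_)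
  simp only [← integral_const_mul, ← Real.exp_add]
  congr with t
  ring_nf

/-! ### The generator and its resolvent -/

section Group

set_option linter.unusedSectionVars false

variable {V : Type*} [NormedAddCommGroup V] [NormedSpace ℝ V]
  [Module ℍ[ℝ]ᵐᵒᵖ V] [IsScalarTower ℝ ℍ[ℝ]ᵐᵒᵖ V]

namespace StronglyContinuousGroup

/-- The operator `U(t)` as a bounded real linear operator. -/
noncomputable def opReal (U : StronglyContinuousGroup V) (t : ℝ) : V →L[ℝ] V where
  toLinearMap := (U.op t).toLinearMap.restrictScalars ℝ
  cont := (U.op t).continuous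

/-- `x` is in the domain of the generator, and the generator maps it to `w`. -/
def GenTo (U : StronglyContinuousGroup V) (x w : V) : Prop :=
  Tendsto (fun h : ℝ => h⁻¹ • (U.op h x - x)) (𝓝[>] 0) (𝓝 w)

theorem GenTo.add {U : StronglyContinuousGroup V} {x y w z : V} (hx : U.GenTo x w)
    (hy : U.GenTo y z) : U.GenTo (x + y) (w + z) := by
  refine (Tendsto.add hx hy).congr fun h => ?_
  rw [map_add, ← smul_add]
  congr 1
  abel

theorem GenTo.smul {U : StronglyContinuousGroup V} {x w : V} (c : ℝ) (hx : U.GenTo x w) :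
    U.GenTo (c • x) (c • w) := by
  refine (Tendsto.const_smul hx c).congr fun h => ?_
  rw [smul_comm, smul_sub, show U.op h (c • x) = c • U.op h x from (U.opReal h).map_smul c x]

theorem GenTo.zero (U : StronglyContinuousGroup V) : U.GenTo 0 0 := by
  simp [GenTo]

theorem GenTo.sum {U : StronglyContinuousGroup V} {ι : Type*} (s : Finset ι) {x w : ι → V}
    (h : ∀ i ∈ s, U.GenTo (x i) (w i)) : U.GenTo (∑ i ∈ s, x i) (∑ i ∈ s, w i) := by
  classical
  induction s using Finset.induction_on with
  | empty => simpa using GenTo.zero U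
  | insert i s hi ih =>
    rw [Finset.sum_insert hi, Finset.sum_insert hi]
    exact (h i (Finset.mem_insert_self i s)).add
      (ih fun j hj => h j (Finset.mem_insert_of_mem hj))

theorem continuous_op_neg (U : StronglyContinuousGroup V) (v : V) :
    Continuous fun t => U.op (-t) v :=
  (U.continuous_op v).comp continuous_neg

/-- The resolvent of the generator at `l`, as a Laplace integral. -/
noncomputable def resolventOp (U : StronglyContinuousGroup V) (l : ℝ) (v : V) : V :=
  ∫ t, U.op (-t) v ∂resolventMeasure l

variable {U : StronglyContinuousGroup V} {M ω : ℝ}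

theorem norm_op_neg_le (hU : ∀ t v, ‖U.op t v‖ ≤ M * Real.exp (ω * |t|) * ‖v‖) (v : V) (t : ℝ) :
    ‖U.op (-t) v‖ ≤ (M * ‖v‖) * Real.exp (ω * |t|) := by
  have := hU (-t) v
  rwa [abs_neg, mul_right_comm] at this

theorem integrable_op_neg (hU : ∀ t v, ‖U.op t v‖ ≤ M * Real.exp (ω * |t|) * ‖v‖) {a : ℝ}
    (ha : ω ≤ a) {σ : Measure ℝ} (hσ : HasExpMoment a σ) (v : V) :
    Integrable (fun t => U.op (-t) v) σ :=
  hσ.integrable (U.continuous_op_neg v) ha (norm_op_neg_le hU v)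

variable [CompleteSpace V]

/-- With g(t) = e^{lt}U(-t)v, applying U(h) to the integral of g over (-∞, 0] gives e^{lh} times its
integral over (-∞, -h]. The product rule and the fundamental theorem of calculus then give the
derivative at h = 0. -/
theorem genTo_resolventOp (hU : ∀ t v, ‖U.op t v‖ ≤ M * Real.exp (ω * |t|) * ‖v‖) {l : ℝ}
    (hl : ω < l) (v : V) : U.GenTo (U.resolventOp l v) (l • U.resolventOp l v - v) := by
  set g : ℝ → V := fun t => Real.exp (l * t) • U.op (-t) v with hg
  have hgc : Continuous g := by
    have := U.continuous_op_neg v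
    fun_prop
  have hint : Integrable (fun t => U.op (-t) v) (resolventMeasure l) :=
    integrable_op_neg hU le_rfl (hasExpMoment_resolventMeasure hl) v
  have hg0 : IntegrableOn g (Set.Iic 0) := integrable_resolventMeasure_iff.1 hint
  have hgi : ∀ b, IntegrableOn g (Set.Iic b) := fun b => by
    have h1 : IntegrableOn g (Set.Icc 0 b) := hgc.continuousOn.integrableOn_Icc
    exact (hg0.union h1).mono_set fun x hx => by
      rcases le_total x 0 with h | h
      · exact Or.inl h
      · exact Or.inr ⟨h, hx⟩
  -- Group law and translation by h: U(h)U(-t) = U(-(t-h)) and e^{lt} = e^{lh}e^{l(t-h)}.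
  have hshift : ∀ h, U.op h (U.resolventOp l v) = Real.exp (l * h) • ∫ t in Set.Iic (-h), g t := by
    intro h
    have h1 : U.op h (U.resolventOp l v) = ∫ t, U.op h (U.op (-t) v) ∂resolventMeasure l :=
      ((U.opReal h).integral_comp_comm hint).symm
    have h2 : Set.Iic (0 : ℝ) = (fun t => t - h) ⁻¹' Set.Iic (-h) := by
      ext t; simp
    rw [h1, integral_resolventMeasure, ← integral_smul, h2]
    rw [← (measurePreserving_sub_right volume h).setIntegral_preimage_emb
      (MeasurableEquiv.subRight h).measurableEmbedding fun t => Real.exp (l * h) • g t]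
    refine integral_congr_ae (ae_of_all _ fun t => ?_)
    simp only [hg, smul_smul, ← Real.exp_add, ← U.op_add]
    ring_nf
  have hG : HasDerivAt (fun b => ∫ t in Set.Iic b, g t) v 0 := by
    have h1 : HasDerivAt (fun b => ∫ t in (0 : ℝ)..b, g t) (g 0) 0 :=
      intervalIntegral.integral_hasDerivAt_right (hgc.intervalIntegrable _ _)
        hgc.stronglyMeasurable.stronglyMeasurableAtFilter hgc.continuousAt
    have h2 := h1.const_add (∫ t in Set.Iic 0, g t)
    have h3 : g 0 = v := by simp [hg, U.op_zero]
    rw [h3] at h2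
    refine h2.congr_of_eventuallyEq (Eventually.of_forall fun b => ?_)
    simp only
    rw [← intervalIntegral.integral_Iic_sub_Iic (hgi 0) (hgi b)]
    abel
  have hG' : HasDerivAt (fun h : ℝ => ∫ t in Set.Iic (-h), g t) (-v) 0 := by
    have := HasDerivAt.scomp (0 : ℝ) (h := fun h : ℝ => -h) (by simpa using hG)
      (hasDerivAt_neg (0 : ℝ))
    simpa [Function.comp_def] using this
  have hE : HasDerivAt (fun h : ℝ => Real.exp (l * h)) l 0 := by
    have := ((hasDerivAt_id (0 : ℝ)).const_mul l).exp
    simpa using this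
  have hfin := (hE.smul hG').tendsto_slope_zero_right
  have hR : U.resolventOp l v = ∫ t in Set.Iic 0, g t := by
    rw [resolventOp, integral_resolventMeasure]
  have hval : Real.exp (l * 0) • -v + l • ∫ t in Set.Iic (-0), g t =
      l • U.resolventOp l v - v := by
    rw [hR, mul_zero, Real.exp_zero, one_smul, neg_zero]
    abel
  rw [hval] at hfin
  refine hfin.congr fun h => ?_
  have h0 := hshift 0
  rw [U.op_zero] at h0
  simp only [zero_add, Pi.smul_apply']
  rw [← hshift h, ← h0]

/-- Since U(-(s+t)) = U(-s)U(-t), convolution of measures becomes composition of operators. -/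
theorem integral_conv_resolventMeasure
    (hU : ∀ t v, ‖U.op t v‖ ≤ M * Real.exp (ω * |t|) * ‖v‖) {a l : ℝ} (ha : 0 ≤ a) (hωa : ω ≤ a)
    (hl : a < l) {σ : Measure ℝ} (hσ : HasExpMoment a σ) (v : V) :
    ∫ t, U.op (-t) v ∂(resolventMeasure l ∗ σ) = U.resolventOp l (∫ t, U.op (-t) v ∂σ) := by
  have hρ := hasExpMoment_resolventMeasure hl
  have := hσ.isFiniteMeasure ha
  have := hρ.isFiniteMeasure ha
  rw [integral_conv (integrable_op_neg hU hωa (hρ.conv ha hσ) v), resolventOp]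
  refine integral_congr_ae (ae_of_all _ fun s => ?_)
  simp only [neg_add, U.op_add]
  exact (U.opReal (-s)).integral_comp_comm (integrable_op_neg hU hωa hσ v)

theorem resolventOp_sub (hU : ∀ t v, ‖U.op t v‖ ≤ M * Real.exp (ω * |t|) * ‖v‖) {l : ℝ}
    (hl : ω < l) (v w : V) :
    U.resolventOp l (v - w) = U.resolventOp l v - U.resolventOp l w := by
  have hρ := hasExpMoment_resolventMeasure hl
  simp only [resolventOp, map_sub]
  exact integral_sub (integrable_op_neg hU le_rfl hρ v) (integrable_op_neg hU le_rfl hρ w)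

end StronglyContinuousGroup

end Group

/-! ### Real measures: induction on the degree of the polynomial -/

section Chain

variable {V : Type*} [NormedAddCommGroup V] [NormedSpace ℝ V]
  [Module ℍ[ℝ]ᵐᵒᵖ V] [IsScalarTower ℝ ℍ[ℝ]ᵐᵒᵖ V]

namespace StronglyContinuousGroup

/-- If `P` has degree `m`, the generator maps `∑ aₖ zₖ` to `w`, and it maps `zₖ` to `zₖ₊₁` for
`k < m`, then `z` can be continued by one more step. -/
theorem exists_chain_succ {U : StronglyContinuousGroup V} {m : ℕ} {c : ℕ → ℝ} {z : ℕ → V}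
    {n w : V} (hc : c m ≠ 0) (hz : ∀ k < m, U.GenTo (z k) (z (k + 1)))
    (hn : ∑ k ∈ Finset.range (m + 1), c k • z k = n) (hw : U.GenTo n w) :
    ∃ z' : ℕ → V, (∀ k ≤ m, z' k = z k) ∧ (∀ k ≤ m, U.GenTo (z' k) (z' (k + 1))) ∧
      ∑ k ∈ Finset.range (m + 1), c k • z' (k + 1) = w := by
  -- This is what the generator must give on the leading term `c m • z m`; dividing by `c m` yields
  -- the new entry.
  set w' : V := w + (-1 : ℝ) • ∑ k ∈ Finset.range m, c k • z (k + 1) with hw'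
  have hzm : U.GenTo (z m) ((c m)⁻¹ • w') := by
    have h1 : U.GenTo (∑ k ∈ Finset.range m, c k • z k)
        (∑ k ∈ Finset.range m, c k • z (k + 1)) :=
      GenTo.sum _ fun k hk => (hz k (Finset.mem_range.1 hk)).smul (c k)
    have h2 := (hw.add (h1.smul (-1))).smul (c m)⁻¹
    have h3 : (c m)⁻¹ • (n + (-1 : ℝ) • ∑ k ∈ Finset.range m, c k • z k) = z m := by
      rw [← hn, Finset.sum_range_succ, neg_one_smul, add_neg_cancel_comm, smul_smul,
        inv_mul_cancel₀ hc, one_smul]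
    rwa [h3] at h2
  have hlow : ∀ k ≤ m, Function.update z (m + 1) ((c m)⁻¹ • w') k = z k := fun k hk =>
    Function.update_of_ne (by omega) _ _
  refine ⟨Function.update z (m + 1) ((c m)⁻¹ • w'), hlow, fun k hk => ?_, ?_⟩
  · rw [hlow k hk]
    rcases hk.lt_or_eq with hk | rfl
    · rw [hlow (k + 1) hk]
      exact hz k hk
    · rwa [Function.update_self]
  · rw [Finset.sum_range_succ, Function.update_self, smul_smul, mul_inv_cancel₀ hc, one_smul,
      Finset.sum_congr rfl fun k hk => by rw [hlow (k + 1) (Finset.mem_range.1 hk)], hw']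
    module

variable [CompleteSpace V]

/-- The product rule for the real functional calculus: if `P` times the Laplace transform of `p` is
the Laplace transform of `q`, then `P` of the generator maps `p(T) v` to `q(T) v`. -/
theorem exists_chain_of_laplace {U : StronglyContinuousGroup V} {M ω a : ℝ}
    (hU : ∀ t v, ‖U.op t v‖ ≤ M * Real.exp (ω * |t|) * ‖v‖) (hω : 0 ≤ ω) (ha : ω < a)
    {p : Measure ℝ × Measure ℝ} (hp : HasExpMoment a p.1 ∧ HasExpMoment a p.2) (v : V) (m : ℕ) :
    ∀ (P : ℝ[X]) (q : Measure ℝ × Measure ℝ), P.natDegree = m →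
      HasExpMoment a q.1 ∧ HasExpMoment a q.2 →
      (∀ x : ℝ, |x| < a → P.eval x * diffIntegral p (fun t => Real.exp (-(t * x))) =
        diffIntegral q (fun t => Real.exp (-(t * x)))) →
      ∃ z : ℕ → V, z 0 = diffIntegral p (fun t => U.op (-t) v) ∧
        (∀ k < m, U.GenTo (z k) (z (k + 1))) ∧
        ∑ k ∈ Finset.range (m + 1), P.coeff k • z k = diffIntegral q (fun t => U.op (-t) v) := by
  have ha0 : 0 < a := hω.trans_lt ha
  have hi : ∀ {σ : Measure ℝ}, HasExpMoment a σ → Integrable (fun t => U.op (-t) v) σ :=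
    fun hσ => integrable_op_neg hU ha.le hσ v
  induction m with
  | zero =>
    intro P q hP hq h
    refine ⟨fun _ => diffIntegral p (fun t => U.op (-t) v), rfl, by simp, ?_⟩
    rw [zero_add, Finset.sum_range_one]
    refine diffIntegral_eq_smul_of_laplace ha0 hq hp (fun x hx => ?_) (U.continuous_op_neg v) ha.le
      (norm_op_neg_le hU v)
    rw [← h x hx, eq_C_of_natDegree_eq_zero hP]
    simp
  | succ m ih =>
    intro P q hP hq h
    -- Any l > a works: the resolvent measure then has a moment of order `a`.
    obtain ⟨l, hl⟩ := exists_gt a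
    set Q : ℝ[X] := P /ₘ (X - C l) with hQ
    have hPQ : P = (X - C l) * Q + C (P.eval l) := by
      rw [← modByMonic_X_sub_C_eq_C_eval, add_comm, hQ]
      exact (modByMonic_add_div P (X - C l)).symm
    have hQdeg : Q.natDegree = m := by
      rw [hQ, natDegree_divByMonic P (monic_X_sub_C l), hP, natDegree_X_sub_C]
      rfl
    have hQm : Q.coeff m ≠ 0 := by
      have h1 : Q.leadingCoeff = P.leadingCoeff :=
        leadingCoeff_divByMonic_X_sub_C P (fun h0 => by
          have : P.natDegree = 0 := natDegree_eq_of_degree_eq_some (by exact_mod_cast h0)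
          omega) l
      rw [← hQdeg, coeff_natDegree, h1, Ne, leadingCoeff_eq_zero]
      rintro rfl
      simp at hP
    -- The transform of `r` is (P(x) - P(l)) times that of `p`, that is, (x - l)Q(x) times it.
    set r := diffSubSMul q (P.eval l) p with hr
    have hrm : HasExpMoment a r.1 ∧ HasExpMoment a r.2 := HasExpMoment.diffSubSMul hq hp
    have hρ := hasExpMoment_resolventMeasure hl
    -- The halves of `r` are swapped because convolution divides by l - x, whereas x - l is wanted.
    obtain ⟨z, hz0, hz, hzn⟩ := ih Q (resolventMeasure l ∗ r.2, resolventMeasure l ∗ r.1) hQdeg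
      ⟨hρ.conv ha0.le hrm.2, hρ.conv ha0.le hrm.1⟩ fun x hx => by
        have hix : ∀ {σ : Measure ℝ}, HasExpMoment a σ →
            Integrable (fun t => Real.exp (-(t * x))) σ :=
          fun hσ => hσ.integrable (by fun_prop) hx.le (norm_exp_neg_mul_le x)
        have h1 := diffIntegral_diffSubSMul q p (P.eval l) (hix hq.1) (hix hq.2) (hix hp.1)
          (hix hp.2)
        have h2 : P.eval x = (x - l) * Q.eval x + P.eval l := by
          conv_lhs => rw [hPQ]
          simp
        have hlx : l - x ≠ 0 := (sub_pos.2 ((le_abs_self x).trans_lt (hx.trans hl))).ne'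
        rw [← hr, ← h x hx, h2, smul_eq_mul] at h1
        rw [diffIntegral] at h1
        simp only [diffIntegral] at h1 ⊢
        rw [laplace_conv_resolventMeasure ha0.le hl hrm.1 hx,
          laplace_conv_resolventMeasure ha0.le hl hrm.2 hx, ← mul_sub, eq_inv_mul_iff_mul_eq₀ hlx]
        linear_combination h1
    set y := diffIntegral p (fun t => U.op (-t) v) with hy
    have hYr : diffIntegral r (fun t => U.op (-t) v) =
        diffIntegral q (fun t => U.op (-t) v) - P.eval l • y :=
      diffIntegral_diffSubSMul q p (P.eval l) (hi hq.1) (hi hq.2) (hi hp.1) (hi hp.2)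
    have hR : diffIntegral (resolventMeasure l ∗ r.2, resolventMeasure l ∗ r.1)
        (fun t => U.op (-t) v) =
        (-1 : ℝ) • U.resolventOp l (diffIntegral r (fun t => U.op (-t) v)) := by
      rw [diffIntegral, integral_conv_resolventMeasure hU ha0.le ha.le hl hrm.1,
        integral_conv_resolventMeasure hU ha0.le ha.le hl hrm.2, diffIntegral,
        resolventOp_sub hU (ha.trans hl)]
      module
    set n := diffIntegral (resolventMeasure l ∗ r.2, resolventMeasure l ∗ r.1)
        (fun t => U.op (-t) v) with hn
    have hgen : U.GenTo n (l • n + (diffIntegral q (fun t => U.op (-t) v) - P.eval l • y)) := by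
      have h1 := (genTo_resolventOp hU (ha.trans hl)
        (diffIntegral r (fun t => U.op (-t) v))).smul (-1)
      rw [← hR] at h1
      have h2 : (-1 : ℝ) • (l • U.resolventOp l (diffIntegral r (fun t => U.op (-t) v)) -
          diffIntegral r (fun t => U.op (-t) v)) =
          l • n + (diffIntegral q (fun t => U.op (-t) v) - P.eval l • y) := by
        rw [hR, ← hYr]
        module
      rwa [h2] at h1
    obtain ⟨z', hz', hzg, hzs⟩ := exists_chain_succ hQm hz hzn hgen
    refine ⟨z', by rw [hz' 0 m.zero_le, hz0], fun k hk => hzg k (Nat.lt_succ_iff.1 hk), ?_⟩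
    -- The extra top term is harmless: the coefficient of `Q` at m + 1 is zero.
    have hsum : ∑ k ∈ Finset.range (m + 1), Q.coeff (k + 1) • z' (k + 1) + Q.coeff 0 • z' 0 =
        n := by
      rw [← Finset.sum_range_succ' (fun k => Q.coeff k • z' k), Finset.sum_range_succ,
        coeff_eq_zero_of_natDegree_lt (by omega : Q.natDegree < m + 1), zero_smul, add_zero, ← hzn]
      refine Finset.sum_congr rfl fun k hk => ?_
      rw [hz' k (Nat.lt_succ_iff.1 (Finset.mem_range.1 hk))]
    have hcs : ∀ k, P.coeff (k + 1) = Q.coeff k - l * Q.coeff (k + 1) := fun k => by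
      conv_lhs => rw [hPQ]
      rw [sub_mul]
      simp [coeff_X_mul]
    have hc0 : P.coeff 0 = -l * Q.coeff 0 + P.eval l := by
      conv_lhs => rw [hPQ]
      simp
    rw [Finset.sum_range_succ' (fun k => P.coeff k • z' k), hc0]
    simp only [hcs, sub_smul, Finset.sum_sub_distrib, mul_smul, ← Finset.smul_sum]
    rw [hzs, add_smul, hz' 0 m.zero_le, hz0, mul_smul]
    rw [hz' 0 m.zero_le, hz0] at hsum
    rw [← hsum]
    module

end StronglyContinuousGroup

end Chain

/-! ### Components of a quaternionic measure -/

/-- The quaternion units `1, i, j, k`. -/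
def quatUnit : Fin 4 → ℍ[ℝ] := ![⟨1, 0, 0, 0⟩, ⟨0, 1, 0, 0⟩, ⟨0, 0, 1, 0⟩, ⟨0, 0, 0, 1⟩]

/-- The coordinates with respect to `1, i, j, k`. -/
noncomputable def quatCoord (n : Fin 4) : ℍ[ℝ] →L[ℝ] ℝ :=
  LinearMap.toContinuousLinearMap
    { toFun := fun q => ![q.re, q.imI, q.imJ, q.imK] n
      map_add' := fun p q => by fin_cases n <;> simp
      map_smul' := fun c q => by fin_cases n <;> simp }

theorem quatCoord_apply (n : Fin 4) (q : ℍ[ℝ]) :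
    quatCoord n q = ![q.re, q.imI, q.imJ, q.imK] n := rfl

theorem sum_quatCoord_smul (q : ℍ[ℝ]) : ∑ n, quatCoord n q • quatUnit n = q := by
  simp only [Fin.sum_univ_four, quatCoord_apply, quatUnit]
  ext
  · change q.re * 1 + q.imI * 0 + q.imJ * 0 + q.imK * 0 = q.re
    ring
  · change q.re * 0 + q.imI * 1 + q.imJ * 0 + q.imK * 0 = q.imI
    ring
  · change q.re * 0 + q.imI * 0 + q.imJ * 1 + q.imK * 0 = q.imJ
    ring
  · change q.re * 0 + q.imI * 0 + q.imJ * 0 + q.imK * 1 = q.imK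
    ring

theorem norm_quatCoord_le (n : Fin 4) (q : ℍ[ℝ]) : ‖quatCoord n q‖ ≤ ‖q‖ := by
  refine abs_le_of_sq_le_sq ?_ (norm_nonneg q)
  rw [sq ‖q‖, ← Quaternion.normSq_eq_norm_mul_self, Quaternion.normSq_def', quatCoord_apply]
  fin_cases n <;> simp <;> nlinarith [sq_nonneg q.re, sq_nonneg q.imI, sq_nonneg q.imJ,
    sq_nonneg q.imK]

/-- A coordinate of a quaternionic measure. -/
noncomputable def component (μ : VectorMeasure ℝ ℍ[ℝ]) (n : Fin 4) : SignedMeasure ℝ :=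
  μ.mapRange (quatCoord n).toLinearMap.toAddMonoidHom (quatCoord n).continuous

/-- The Jordan decomposition of a coordinate of a quaternionic measure. -/
noncomputable def componentPair (μ : VectorMeasure ℝ ℍ[ℝ]) (n : Fin 4) :
    Measure ℝ × Measure ℝ :=
  ((component μ n).toJordanDecomposition.posPart, (component μ n).toJordanDecomposition.negPart)

instance (μ : VectorMeasure ℝ ℍ[ℝ]) (n : Fin 4) : IsFiniteMeasure (componentPair μ n).1 :=
  (component μ n).toJordanDecomposition.posPart_finite

instance (μ : VectorMeasure ℝ ℍ[ℝ]) (n : Fin 4) : IsFiniteMeasure (componentPair μ n).2 :=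
  (component μ n).toJordanDecomposition.negPart_finite

theorem component_apply (μ : VectorMeasure ℝ ℍ[ℝ]) (n : Fin 4) (s : Set ℝ) :
    component μ n s = quatCoord n (μ s) := rfl

/-- Coordinates do not increase the norm. Hence exponential moments of |μ| pass to all the Jordan
parts. -/
theorem totalVariation_component_le (μ : VectorMeasure ℝ ℍ[ℝ]) (n : Fin 4) :
    (component μ n).totalVariation ≤ μ.variation := by
  rw [SignedMeasure.totalVariation_eq_variation]
  refine VectorMeasure.variation_le_of_forall_enorm_le fun E _ => ?_
  refine le_trans ?_ (μ.enorm_measure_le_variation E)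
  rw [component_apply, enorm_le_iff_norm_le]
  exact norm_quatCoord_le n _

theorem componentPair_fst_le (μ : VectorMeasure ℝ ℍ[ℝ]) (n : Fin 4) :
    (componentPair μ n).1 ≤ μ.variation :=
  (Measure.le_add_right le_rfl).trans (totalVariation_component_le μ n)

theorem componentPair_snd_le (μ : VectorMeasure ℝ ℍ[ℝ]) (n : Fin 4) :
    (componentPair μ n).2 ≤ μ.variation :=
  (Measure.le_add_left le_rfl).trans (totalVariation_component_le μ n)

theorem component_eq_real_sub_real (μ : VectorMeasure ℝ ℍ[ℝ]) (n : Fin 4) {s : Set ℝ}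
    (hs : MeasurableSet s) :
    quatCoord n (μ s) = (componentPair μ n).1.real s - (componentPair μ n).2.real s :=
  (component μ n).apply_eq_posPart_real_sub_negPart_real hs

/-! ### Quaternionic integrals in coordinates -/

section LeftIntegral

variable {V : Type*} [NormedAddCommGroup V] [NormedSpace ℝ V]

/-- The L¹ distance for σ is at most that for τ. This supplies the closedness needed to pass from
simple to integrable functions. -/
theorem continuous_integral_of_le {σ τ : Measure ℝ} (h : σ ≤ τ) :
    Continuous fun f : ℝ →₁[τ] V => ∫ t, f t ∂σ := by
  rw [continuous_iff_continuousAt]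
  intro f
  refine tendsto_integral_of_L1 _ ((L1.integrable_coeFn f).mono_measure h).aestronglyMeasurable
    (Eventually.of_forall fun g => (L1.integrable_coeFn g).mono_measure h) ?_
  have h1 : Tendsto (fun g : ℝ →₁[τ] V => ∫⁻ t, ‖g t - f t‖ₑ ∂τ) (𝓝 f) (𝓝 0) := by
    have h2 : Tendsto (fun g : ℝ →₁[τ] V => edist g f) (𝓝 f) (𝓝 0) :=
      tendsto_iff_edist_tendsto_0.1 tendsto_id
    refine h2.congr fun g => ?_
    rw [L1.edist_def]
    simp only [edist_eq_enorm_sub]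
  exact tendsto_of_tendsto_of_tendsto_of_le_of_le tendsto_const_nhds h1 (fun _ => zero_le)
    fun g => lintegral_mono' h le_rfl

variable [CompleteSpace V] [Module ℍ[ℝ] V] [IsScalarTower ℝ ℍ[ℝ] V] [NormSMulClass ℍ[ℝ] V]

/-- Integration against a quaternionic measure through its coordinates. -/
theorem leftIntegral_eq_sum (μ : VectorMeasure ℝ ℍ[ℝ]) {F : ℝ → V}
    (hF : Integrable F μ.variation) :
    leftIntegral μ F = ∑ n, quatUnit n • diffIntegral (componentPair μ n) F := by
  have h1 : ∀ {G : ℝ → V} (n : Fin 4), Integrable G μ.variation →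
      Integrable G (componentPair μ n).1 := fun n h => h.mono_measure (componentPair_fst_le μ n)
  have h2 : ∀ {G : ℝ → V} (n : Fin 4), Integrable G μ.variation →
      Integrable G (componentPair μ n).2 := fun n h => h.mono_measure (componentPair_snd_le μ n)
  have : SMulCommClass ℝ ℍ[ℝ] V := IsScalarTower.to_smulCommClass
  refine Integrable.induction (P := fun F => leftIntegral μ F =
    ∑ n, quatUnit n • diffIntegral (componentPair μ n) F) ?_ ?_ ?_ ?_ hF
  · intro c s hs hμs
    have hl : leftIntegral μ (s.indicator fun _ => c) = μ s • c := by
      rw [leftIntegral, VectorMeasure.integral, setToFun_indicator_const _ hs hμs.ne]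
      rfl
    rw [hl]
    conv_lhs => rw [← sum_quatCoord_smul (μ s), Finset.sum_smul]
    refine Finset.sum_congr rfl fun n _ => ?_
    rw [diffIntegral, integral_indicator_const _ hs, integral_indicator_const _ hs, ← sub_smul,
      ← component_eq_real_sub_real μ n hs, smul_assoc, smul_comm]
  · intro f g _ hf hg ihf ihg
    rw [leftIntegral, VectorMeasure.integral_add hf hg]
    simp only [leftIntegral] at ihf ihg
    rw [ihf, ihg, ← Finset.sum_add_distrib]
    refine Finset.sum_congr rfl fun n _ => ?_
    simp only [diffIntegral]
    rw [integral_add' (h1 n hf) (h1 n hg), integral_add' (h2 n hf) (h2 n hg), ← smul_add]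
    congr 1
    abel
  · refine isClosed_eq VectorMeasure.continuous_integral ?_
    refine continuous_finsetSum _ fun n _ => Continuous.const_smul (Continuous.sub ?_ ?_) _
    · exact continuous_integral_of_le (componentPair_fst_le μ n)
    · exact continuous_integral_of_le (componentPair_snd_le μ n)
  · intro f g hfg hf ih
    rw [leftIntegral, ← VectorMeasure.integral_congr_ae hfg]
    rw [leftIntegral] at ih
    rw [ih]
    refine Finset.sum_congr rfl fun n _ => ?_
    simp only [diffIntegral]
    rw [integral_congr_ae (hfg.filter_mono (ae_mono (componentPair_fst_le μ n))),
      integral_congr_ae (hfg.filter_mono (ae_mono (componentPair_snd_le μ n)))]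

end LeftIntegral

/-! ### Complex Laplace transforms -/

/-- The Laplace transform of a difference of measures, as a function of a complex variable. -/
noncomputable def complexLaplace (p : Measure ℝ × Measure ℝ) (z : ℂ) : ℂ :=
  diffIntegral p fun t => Complex.exp (-(t * z))

theorem complexLaplace_ofReal (p : Measure ℝ × Measure ℝ) (x : ℝ) :
    complexLaplace p x = (diffIntegral p (fun t => Real.exp (-(t * x))) : ℝ) := by
  have h : ∀ t : ℝ, Complex.exp (-(t * x)) = (Real.exp (-(t * x)) : ℝ) := fun t => by push_cast; rfl
  simp only [complexLaplace, diffIntegral, h]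
  rw [integral_complex_ofReal, integral_complex_ofReal, Complex.ofReal_sub]

theorem analyticAt_complexLaplace {a : ℝ} {p : Measure ℝ × Measure ℝ}
    (hp : HasExpMoment a p.1 ∧ HasExpMoment a p.2) {z : ℂ} (hz : |z.re| < a) :
    AnalyticAt ℂ (complexLaplace p) z := by
  have key : ∀ {σ : Measure ℝ}, HasExpMoment a σ →
      AnalyticAt ℂ (fun z : ℂ => ∫ t : ℝ, Complex.exp (-(t * z)) ∂σ) z := by
    intro σ hσ
    have h1 : AnalyticAt ℂ (ProbabilityTheory.complexMGF id σ) (-z) :=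
      ProbabilityTheory.analyticAt_complexMGF
        (hσ.mem_interior_integrableExpSet (by rwa [Complex.neg_re, abs_neg]))
    have h2 := h1.comp (f := fun z : ℂ => -z) analyticAt_id.neg
    refine h2.congr (Eventually.of_forall fun w => ?_)
    simp only [Function.comp, ProbabilityTheory.complexMGF, id]
    congr with t
    ring_nf
  exact (key hp.1).sub (key hp.2)

/-- A polynomial identity between real Laplace transforms extends to the complex strip. -/
theorem complexLaplace_eq_aeval_mul {a : ℝ} (ha : 0 < a) {p q : Measure ℝ × Measure ℝ}
    (hp : HasExpMoment a p.1 ∧ HasExpMoment a p.2) (hq : HasExpMoment a q.1 ∧ HasExpMoment a q.2)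
    {P : ℝ[X]} (h : ∀ x : ℝ, |x| < a → P.eval x * diffIntegral p (fun t => Real.exp (-(t * x))) =
        diffIntegral q (fun t => Real.exp (-(t * x)))) :
    ∀ z : ℂ, |z.re| < a → complexLaplace q z = aeval z P * complexLaplace p z := by
  refine eqOn_strip_of_eq_real ha (fun z hz => analyticAt_complexLaplace hq hz)
    (fun z hz => (analyticAt_id.aeval_polynomial P).mul (analyticAt_complexLaplace hp hz))
    fun x hx => ?_
  have h1 : aeval (x : ℂ) P = ((P.eval x : ℝ) : ℂ) := by
    rw [← Complex.coe_algebraMap, aeval_algebraMap_apply, coe_aeval_eq_eval]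
  change complexLaplace q x = aeval (x : ℂ) P * complexLaplace p x
  rw [complexLaplace_ofReal, complexLaplace_ofReal, ← h x hx, h1, Complex.ofReal_mul]

theorem componentPair_hasExpMoment {a : ℝ} {μ : VectorMeasure ℝ ℍ[ℝ]}
    (hμ : HasExpMoment a μ.variation) (n : Fin 4) :
    HasExpMoment a (componentPair μ n).1 ∧ HasExpMoment a (componentPair μ n).2 :=
  ⟨hμ.mono_measure (componentPair_fst_le μ n), hμ.mono_measure (componentPair_snd_le μ n)⟩

theorem norm_exp_quat_le (s : ℍ[ℝ]) (t : ℝ) :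
    ‖NormedSpace.exp (-(t • s))‖ ≤ 1 * Real.exp (|s.re| * |t|) := by
  rw [Quaternion.norm_exp, ← Real.exp_eq_exp_ℝ]
  have := norm_exp_neg_mul_le s.re t
  simpa using this

theorem continuous_exp_quat (s : ℍ[ℝ]) : Continuous fun t : ℝ => NormedSpace.exp (-(t • s)) := by
  let _ : NormedAlgebra ℚ ℍ[ℝ] := NormedAlgebra.restrictScalars ℚ ℝ ℍ[ℝ]
  exact NormedSpace.exp_continuous.comp (by fun_prop)

/-- The quaternionic Laplace transform on a complex plane `ι(ℂ)` inside the quaternions. -/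
theorem leftIntegral_exp_eq_sum {a : ℝ} {μ : VectorMeasure ℝ ℍ[ℝ]}
    (hμ : HasExpMoment a μ.variation) (ι : ℂ →ₐ[ℝ] ℍ[ℝ]) (hι : ∀ z, (ι z).re = z.re) {z : ℂ}
    (hz : |z.re| < a) :
    leftIntegral μ (fun t => NormedSpace.exp (-(t • ι z))) =
      ∑ n, quatUnit n * ι (complexLaplace (componentPair μ n) z) := by
  have hb : ∀ t : ℝ, ‖Complex.exp (-(t * z))‖ ≤ 1 * Real.exp (|z.re| * |t|) := fun t => by
    have := norm_exp_neg_mul_le z.re t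
    rw [Complex.norm_exp]
    simpa using this
  -- A continuous algebra homomorphism commutes with the exponential series.
  have hexp : ∀ t : ℝ, NormedSpace.exp (-(t • ι z)) = ι (Complex.exp (-(t * z))) := fun t => by
    have hc : Continuous ι := ι.toLinearMap.continuous_of_finiteDimensional
    rw [Complex.exp_eq_exp_ℂ, NormedSpace.map_exp ι hc, map_neg, ← Complex.real_smul, map_smul]
  rw [leftIntegral_eq_sum μ (hμ.integrable (continuous_exp_quat _) (C := 1)
    (b := |(ι z).re|) (by rw [hι]; exact hz.le) (norm_exp_quat_le _))]
  refine Finset.sum_congr rfl fun n _ => ?_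
  have hi : ∀ {σ : Measure ℝ}, HasExpMoment a σ →
      ∫ t : ℝ, ι (Complex.exp (-(t * z))) ∂σ = ι (∫ t : ℝ, Complex.exp (-(t * z)) ∂σ) :=
    fun hσ => (LinearMap.toContinuousLinearMap ι.toLinearMap).integral_comp_comm
      (hσ.integrable (by fun_prop) hz.le hb)
  simp only [hexp, complexLaplace, diffIntegral, smul_eq_mul, map_sub]
  rw [hi (componentPair_hasExpMoment hμ n).1, hi (componentPair_hasExpMoment hμ n).2]

theorem sum_smul_quatUnit (r : Fin 4 → ℝ) :
    ∑ n, r n • quatUnit n = ⟨r 0, r 1, r 2, r 3⟩ := by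
  simp only [Fin.sum_univ_four, quatUnit]
  ext
  · change r 0 * 1 + r 1 * 0 + r 2 * 0 + r 3 * 0 = r 0
    ring
  · change r 0 * 0 + r 1 * 1 + r 2 * 0 + r 3 * 0 = r 1
    ring
  · change r 0 * 0 + r 1 * 0 + r 2 * 1 + r 3 * 0 = r 2
    ring
  · change r 0 * 0 + r 1 * 0 + r 2 * 0 + r 3 * 1 = r 3
    ring

/-- The complex plane spanned by `1` and an imaginary unit. -/
noncomputable def slice (q : ℍ[ℝ]) (hq : q * q = -1) : ℂ →ₐ[ℝ] ℍ[ℝ] := Complex.lift ⟨q, hq⟩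

theorem slice_apply (q : ℍ[ℝ]) (hq : q * q = -1) (z : ℂ) :
    slice q hq z = algebraMap ℝ ℍ[ℝ] z.re + z.im • q := by
  rw [slice, Complex.lift_apply, Complex.liftAux_apply]

theorem slice_re {q : ℍ[ℝ]} (hq : q * q = -1) (hq0 : q.re = 0) (z : ℂ) :
    (slice q hq z).re = z.re := by
  rw [slice_apply, Quaternion.re_add, Quaternion.re_smul, hq0, smul_zero, add_zero]
  rfl

theorem leftIntegral_exp_real {a : ℝ} {μ : VectorMeasure ℝ ℍ[ℝ]}
    (hμ : HasExpMoment a μ.variation) {x : ℝ} (hx : |x| < a) :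
    leftIntegral μ (fun t => NormedSpace.exp (-(t • (x : ℍ[ℝ])))) =
      ∑ n, diffIntegral (componentPair μ n) (fun t => Real.exp (-(t * x))) • quatUnit n := by
  have hi : (⟨0, 1, 0, 0⟩ : ℍ[ℝ]) * ⟨0, 1, 0, 0⟩ = -1 := by ext <;> simp
  have hof : ∀ r : ℝ, slice _ hi (r : ℂ) = algebraMap ℝ ℍ[ℝ] r := fun r => (slice _ hi).commutes r
  have := leftIntegral_exp_eq_sum hμ (slice _ hi) (slice_re hi rfl) (z := x) (by simpa using hx)
  rw [hof] at this
  refine this.trans (Finset.sum_congr rfl fun n _ => ?_)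
  rw [complexLaplace_ofReal, hof, Algebra.smul_def, Algebra.commutes]

/-! ### Nonconstant polynomials force the measure to be real -/

/-- A nonconstant real polynomial takes nonreal values near every point. -/
theorem frequently_im_aeval_ne_zero {P : ℝ[X]} (hP : P.natDegree ≠ 0) (z : ℂ) :
    ∃ᶠ w in 𝓝 z, (aeval w P).im ≠ 0 := by
  rw [Filter.Frequently]
  simp only [not_not]
  intro h
  have han : AnalyticAt ℂ (fun w : ℂ => aeval w P) z := analyticAt_id.aeval_polynomial P
  -- Open mapping: either the polynomial is locally constant, hence constant, or its values near z
  -- fill a neighbourhood and cannot all be real.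
  rcases han.eventually_constant_or_nhds_le_map_nhds with hc | hm
  · have hinf : {w : ℂ | aeval w P = aeval z P}.Infinite := infinite_of_mem_nhds z hc
    have heq : P.map (algebraMap ℝ ℂ) = C (aeval z P) := by
      refine eq_of_infinite_eval_eq _ _ (hinf.mono fun w hw => ?_)
      simpa [eval_map_algebraMap] using hw
    have hdeg := congrArg natDegree heq
    rw [natDegree_C, natDegree_map] at hdeg
    exact hP hdeg
  · have h2 : ∀ᶠ w in 𝓝 (aeval z P), w.im = 0 := hm h
    have h3 : Tendsto (fun y : ℝ => aeval z P + y * Complex.I) (𝓝[≠] 0) (𝓝 (aeval z P)) := by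
      have hcont : Continuous fun y : ℝ => aeval z P + y * Complex.I := by fun_prop
      exact (hcont.tendsto' 0 _ (by simp)).mono_left nhdsWithin_le_nhds
    obtain ⟨y, hy, hy0⟩ := ((h3.eventually h2).and self_mem_nhdsWithin).exists
    refine hy0 ?_
    have hz : (aeval z P).im = 0 := h.self_of_nhds
    simpa [hz] using hy

/-- If `P` times the transform of `μ` is the transform of `ν` for a nonconstant real polynomial `P`,
then the transform of `μ` commutes with every imaginary unit on the real axis. -/
theorem commute_laplace_of_nonconstant {a : ℝ} (ha : 0 < a) {μ ν : VectorMeasure ℝ ℍ[ℝ]}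
    (hμ : HasExpMoment a μ.variation) (hν : HasExpMoment a ν.variation) {P : ℝ[X]}
    (hP : P.natDegree ≠ 0)
    (hr : ∀ n, ∀ x : ℝ, |x| < a →
      P.eval x * diffIntegral (componentPair μ n) (fun t => Real.exp (-(t * x))) =
        diffIntegral (componentPair ν n) (fun t => Real.exp (-(t * x))))
    (h : ∀ s : ℍ[ℝ], |s.re| < a →
      aeval s P * leftIntegral μ (fun t => NormedSpace.exp (-(t • s))) =
        leftIntegral ν (fun t => NormedSpace.exp (-(t • s))))
    {q : ℍ[ℝ]} (hq : q * q = -1) (hq0 : q.re = 0) {x : ℝ} (hx : |x| < a) :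
    q * leftIntegral μ (fun t => NormedSpace.exp (-(t • (x : ℍ[ℝ])))) =
      leftIntegral μ (fun t => NormedSpace.exp (-(t • (x : ℍ[ℝ])))) * q := by
  set ι := slice q hq with hι
  have hre : ∀ z, (ι z).re = z.re := slice_re hq hq0
  set F : ℂ → ℍ[ℝ] := fun z => ∑ n, quatUnit n * ι (complexLaplace (componentPair μ n) z) with hF
  have hFμ : ∀ z : ℂ, |z.re| < a →
      leftIntegral μ (fun t => NormedSpace.exp (-(t • ι z))) = F z := fun z hz =>
    leftIntegral_exp_eq_sum hμ ι hre hz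
  have hιx : ι (x : ℂ) = (x : ℍ[ℝ]) := ι.commutes x
  have hcomm : ∀ z : ℂ, |z.re| < a → (aeval z P).im ≠ 0 → q * F z = F z * q := by
    intro z hz him
    have h1 := h (ι z) (by rwa [hre])
    rw [hFμ z hz, leftIntegral_exp_eq_sum hν ι hre hz, aeval_algHom_apply] at h1
    -- The units stand on the left, so the common factor P(z) leaves the sum on the right.
    have h2 : ∑ n, quatUnit n * ι (complexLaplace (componentPair ν n) z) =
        F z * ι (aeval z P) := by
      rw [hF, Finset.sum_mul]
      refine Finset.sum_congr rfl fun n _ => ?_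
      rw [complexLaplace_eq_aeval_mul ha (componentPair_hasExpMoment hμ n)
        (componentPair_hasExpMoment hν n) (hr n) z hz, mul_comm, map_mul, mul_assoc]
    -- In P(z)F = F P(z) the real part of P(z) is central and cancels; what remains is Im P(z) times
    -- the commutation with q.
    rw [h2, hι, slice_apply, add_mul, mul_add, Algebra.commutes, add_right_inj, smul_mul_assoc,
      mul_smul_comm] at h1
    exact smul_right_injective _ him h1
  have hxa : |(x : ℂ).re| < a := by simpa using hx
  have hFc : ContinuousAt F x := by
    have hιc : Continuous ι := ι.toLinearMap.continuous_of_finiteDimensional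
    refine tendsto_finsetSum _ fun n _ => ?_
    exact tendsto_const_nhds.mul ((hιc.tendsto _).comp
      (analyticAt_complexLaplace (componentPair_hasExpMoment hμ n) hxa).continuousAt)
  have hev : ∀ᶠ z : ℂ in 𝓝 (x : ℂ), |z.re| < a :=
    (isOpen_lt (by fun_prop) continuous_const).mem_nhds hxa
  -- Failure to commute is an open condition, while points with P(z) not real accumulate at x.
  have hfin : q * F x = F x * q := by
    by_contra hne
    have h4 : ∀ᶠ z in 𝓝 (x : ℂ), q * F z ≠ F z * q :=
      (hFc.const_mul q).ne_iff_eventually_ne (hFc.mul_const q) |>.1 hne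
    obtain ⟨z, him, hz, hz'⟩ :=
      ((frequently_im_aeval_ne_zero hP x).and_eventually (hev.and h4)).exists
    exact hz' (hcomm z hz him)
  rw [← hFμ x hxa, hιx] at hfin
  exact hfin

theorem quat_commute_i {q p : ℍ[ℝ]} (hq : q = ⟨0, 1, 0, 0⟩) (h : q * p = p * q) :
    p.imJ = 0 ∧ p.imK = 0 := by
  have h1 := congrArg QuaternionAlgebra.imJ h
  have h2 := congrArg QuaternionAlgebra.imK h
  rw [Quaternion.imJ_mul, Quaternion.imJ_mul, hq] at h1
  rw [Quaternion.imK_mul, Quaternion.imK_mul, hq] at h2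
  constructor <;> linarith

theorem quat_commute_j {q p : ℍ[ℝ]} (hq : q = ⟨0, 0, 1, 0⟩) (h : q * p = p * q) :
    p.imI = 0 ∧ p.imK = 0 := by
  have h1 := congrArg QuaternionAlgebra.imI h
  have h2 := congrArg QuaternionAlgebra.imK h
  rw [Quaternion.imI_mul, Quaternion.imI_mul, hq] at h1
  rw [Quaternion.imK_mul, Quaternion.imK_mul, hq] at h2
  constructor <;> linarith

/-- In the situation of `commute_laplace_of_nonconstant`, the measure `μ` is real. -/
theorem componentPair_fst_eq_snd {a : ℝ} (ha : 0 < a) {μ ν : VectorMeasure ℝ ℍ[ℝ]}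
    (hμ : HasExpMoment a μ.variation) (hν : HasExpMoment a ν.variation) {P : ℝ[X]}
    (hP : P.natDegree ≠ 0)
    (hr : ∀ n, ∀ x : ℝ, |x| < a →
      P.eval x * diffIntegral (componentPair μ n) (fun t => Real.exp (-(t * x))) =
        diffIntegral (componentPair ν n) (fun t => Real.exp (-(t * x))))
    (h : ∀ s : ℍ[ℝ], |s.re| < a →
      aeval s P * leftIntegral μ (fun t => NormedSpace.exp (-(t • s))) =
        leftIntegral ν (fun t => NormedSpace.exp (-(t • s)))) {n : Fin 4} (hn : n ≠ 0) :
    (componentPair μ n).1 = (componentPair μ n).2 := by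
  refine fst_eq_snd_of_laplace_eq_zero ha (componentPair_hasExpMoment hμ n) fun x hx => ?_
  have hi : (⟨0, 1, 0, 0⟩ : ℍ[ℝ]) * ⟨0, 1, 0, 0⟩ = -1 := by ext <;> simp
  have hj : (⟨0, 0, 1, 0⟩ : ℍ[ℝ]) * ⟨0, 0, 1, 0⟩ = -1 := by ext <;> simp
  have h1 := commute_laplace_of_nonconstant ha hμ hν hP hr h hi rfl hx
  have h2 := commute_laplace_of_nonconstant ha hμ hν hP hr h hj rfl hx
  rw [leftIntegral_exp_real hμ hx, sum_smul_quatUnit] at h1 h2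
  have h3 := quat_commute_i rfl h1
  have h4 := quat_commute_j rfl h2
  fin_cases n
  · exact absurd rfl hn
  · change diffIntegral (componentPair μ 1) (fun t => Real.exp (-(t * x))) = 0
    exact h4.1
  · change diffIntegral (componentPair μ 2) (fun t => Real.exp (-(t * x))) = 0
    exact h3.1
  · change diffIntegral (componentPair μ 3) (fun t => Real.exp (-(t * x))) = 0
    exact h3.2

/-! ### Passage from the hypotheses to real data -/

/-- An intrinsic polynomial has real coefficients. -/
theorem IsIntrinsic.exists_map_eq {P : ℍ[ℝ][X]} (hP : IsIntrinsic P) :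
    ∃ Q : ℝ[X], Q.map (algebraMap ℝ ℍ[ℝ]) = P := by
  let coordPoly : Fin 4 → ℝ[X] := fun n =>
    ∑ k ∈ Finset.range (P.natDegree + 1), monomial k (quatCoord n (P.coeff k))
  have hcoeff : ∀ n k, (coordPoly n).coeff k = quatCoord n (P.coeff k) := by
    intro n k
    simp only [coordPoly, finsetSum_coeff, coeff_monomial, Finset.sum_ite_eq', Finset.mem_range]
    split_ifs with h
    · rfl
    · rw [coeff_eq_zero_of_natDegree_lt (by omega), map_zero]
  have heval : ∀ n (x : ℝ), (coordPoly n).eval x = quatCoord n (P.eval (x : ℍ[ℝ])) := by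
    intro n x
    simp only [coordPoly, eval_finsetSum, eval_monomial]
    rw [eval_eq_sum_range, map_sum]
    refine Finset.sum_congr rfl fun k _ => ?_
    rw [← Quaternion.coe_pow, Quaternion.mul_coe_eq_smul, map_smul, smul_eq_mul, mul_comm]
  -- A real x is its own conjugate, so P(x) is real and the imaginary coordinate polynomials vanish
  -- on all of ℝ.
  have hzero : ∀ n, n ≠ 0 → coordPoly n = 0 := by
    intro n hn
    refine Polynomial.funext fun x => ?_
    have h1 := hP (x : ℍ[ℝ])
    rw [Quaternion.star_coe, Quaternion.ext_iff] at h1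
    simp at h1
    rw [heval, eval_zero, quatCoord_apply]
    fin_cases n
    · exact absurd rfl hn
    · change (P.eval (x : ℍ[ℝ])).imI = 0
      linarith
    · change (P.eval (x : ℍ[ℝ])).imJ = 0
      linarith
    · change (P.eval (x : ℍ[ℝ])).imK = 0
      linarith
  refine ⟨coordPoly 0, Polynomial.ext fun k => ?_⟩
  rw [coeff_map, hcoeff]
  have h0 : ∀ n, n ≠ 0 → quatCoord n (P.coeff k) = 0 := fun n hn => by
    rw [← hcoeff, hzero n hn, coeff_zero]
  ext
  · rfl
  · exact (h0 1 (by decide)).symm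
  · exact (h0 2 (by decide)).symm
  · exact (h0 3 (by decide)).symm

/-- The ε for f and the ε for `Pf` may differ; allowing every smaller exponent lets both use one
common strip. -/
theorem IsLaplaceStieltjes.exists_hasExpMoment {ω : ℝ} {μ : VectorMeasure ℝ ℍ[ℝ]}
    {f : ℍ[ℝ] → ℍ[ℝ]} (h : IsLaplaceStieltjes ω μ f) :
    ∃ b > ω, ∀ a ≤ b, HasExpMoment a μ.variation ∧ ∀ s : ℍ[ℝ], |s.re| < a →
      f s = leftIntegral μ fun t => NormedSpace.exp (-(t • s)) := by
  obtain ⟨ε, hε, hfin, hf⟩ := h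
  refine ⟨ω + ε, by linarith, fun a ha => ⟨?_, fun s hs => ?_⟩⟩
  · have h1 : HasExpMoment (ω + ε) μ.variation := by
      refine ⟨(by fun_prop : Continuous fun t : ℝ =>
        Real.exp ((ω + ε) * |t|)).aestronglyMeasurable, ?_⟩
      rwa [hasFiniteIntegral_iff_ofReal (ae_of_all _ fun t => (Real.exp_pos _).le)]
    refine h1.integrable (by fun_prop) (C := 1) ha fun t => ?_
    rw [one_mul, Real.norm_eq_abs, Real.abs_exp]
  · have := abs_lt.1 hs
    exact hf s (by linarith) (by linarith)

/-! ### Powers and polynomials of the generator -/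

section Generator

variable {V : Type*} [NormedAddCommGroup V] [NormedSpace ℝ V]
  [Module ℍ[ℝ]ᵐᵒᵖ V] [IsScalarTower ℝ ℍ[ℝ]ᵐᵒᵖ V] [NormSMulClass ℍ[ℝ]ᵐᵒᵖ V]

theorem StronglyContinuousGroup.GenTo.generator_eq {U : StronglyContinuousGroup V} {x w : V}
    (h : U.GenTo x w) : ∃ hx : x ∈ U.generator.domain, U.generator ⟨x, hx⟩ = w := by
  have hx : x ∈ U.generator.domain := ⟨w, h⟩
  exact ⟨hx, tendsto_nhds_unique (Exists.choose_spec hx) h⟩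

/-- A chain for the generator computes its powers. -/
theorem ppow_generator_eq_of_chain {U : StronglyContinuousGroup V} {m : ℕ} {z : ℕ → V}
    (hz : ∀ k < m, U.GenTo (z k) (z (k + 1))) (k : ℕ) (hk : k ≤ m) :
    ∃ h : z 0 ∈ (ppow U.generator k).domain, ppow U.generator k ⟨z 0, h⟩ = z k := by
  induction k with
  | zero => exact ⟨Submodule.mem_top, rfl⟩
  | succ k ih =>
    obtain ⟨h, hv⟩ := ih (by omega)
    obtain ⟨hx, hw⟩ := (hz k hk).generator_eq
    have hmem : ppow U.generator k ⟨z 0, h⟩ ∈ U.generator.domain := by rw [hv]; exact hx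
    refine ⟨⟨⟨z 0, h⟩, hmem, rfl⟩, ?_⟩
    rw [← hw]
    change U.generator ⟨ppow U.generator k ⟨z 0, h⟩, hmem⟩ = _
    congr 1
    exact Subtype.ext hv

end Generator

section Assembly

variable {V : Type*} [NormedAddCommGroup V] [NormedSpace ℝ V] [Module ℍ[ℝ] V]
  [IsScalarTower ℝ ℍ[ℝ] V] [Module ℍ[ℝ]ᵐᵒᵖ V] [SMulCommClass ℍ[ℝ] ℍ[ℝ]ᵐᵒᵖ V]

/-- The embedding of ℝ in ℍ preserves the degree, hence the domain, and real quaternions act as real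
scalars. -/
theorem polyOp_apply_of_ppow {T : V →ₗ.[ℍ[ℝ]ᵐᵒᵖ] V} {Q : ℝ[X]} {z : ℕ → V} {y : V}
    (hz : ∀ k ≤ Q.natDegree, ∃ h : y ∈ (ppow T k).domain, ppow T k ⟨y, h⟩ = z k) :
    ∃ h : y ∈ (polyOp (Q.map (algebraMap ℝ ℍ[ℝ])) T).domain,
      polyOp (Q.map (algebraMap ℝ ℍ[ℝ])) T ⟨y, h⟩ =
        ∑ k ∈ Finset.range (Q.natDegree + 1), Q.coeff k • z k := by
  have hdeg : (Q.map (algebraMap ℝ ℍ[ℝ])).natDegree = Q.natDegree := natDegree_map _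
  have hy : y ∈ (polyOp (Q.map (algebraMap ℝ ℍ[ℝ])) T).domain := by
    change y ∈ (ppow T (Q.map (algebraMap ℝ ℍ[ℝ])).natDegree).domain
    rw [hdeg]
    exact (hz _ le_rfl).1
  refine ⟨hy, ?_⟩
  have hsum : polyOp (Q.map (algebraMap ℝ ℍ[ℝ])) T ⟨y, hy⟩ =
      ∑ k : Fin ((Q.map (algebraMap ℝ ℍ[ℝ])).natDegree + 1), Q.coeff k • z k := by
    have : SMulCommClass ℍ[ℝ]ᵐᵒᵖ ℍ[ℝ] V := SMulCommClass.symm _ _ _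
    change (∑ k : Fin ((Q.map (algebraMap ℝ ℍ[ℝ])).natDegree + 1),
      (Q.map (algebraMap ℝ ℍ[ℝ])).coeff k • ((ppow T k).toFun ∘ₗ
        Submodule.inclusion (ppow_domain_antitone T (Nat.lt_succ_iff.mp k.2))) :
        (ppow T (Q.map (algebraMap ℝ ℍ[ℝ])).natDegree).domain →ₗ[ℍ[ℝ]ᵐᵒᵖ] V) ⟨y, hy⟩ = _
    rw [LinearMap.sum_apply]
    refine Finset.sum_congr rfl fun k _ => ?_
    obtain ⟨h, hv⟩ := hz k (by rw [← hdeg]; exact Nat.lt_succ_iff.1 k.2)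
    rw [← hv, ← algebraMap_smul ℍ[ℝ] (Q.coeff k), ← coeff_map]
    rfl
  rw [hsum, Fin.sum_univ_eq_sum_range (fun k => Q.coeff k • z k), hdeg]

end Assembly

end QuatCalc

theorem lemma5p2 {V : Type*} [NormedAddCommGroup V] [NormedSpace ℝ V] [CompleteSpace V]
    [Module ℍ[ℝ] V] [IsScalarTower ℝ ℍ[ℝ] V] [NormSMulClass ℍ[ℝ] V]
    [Module ℍ[ℝ]ᵐᵒᵖ V] [IsScalarTower ℝ ℍ[ℝ]ᵐᵒᵖ V] [NormSMulClass ℍ[ℝ]ᵐᵒᵖ V]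
    [SMulCommClass ℍ[ℝ] ℍ[ℝ]ᵐᵒᵖ V]
    (U : QuatCalc.StronglyContinuousGroup V) (M ω : ℝ) (hω : 0 ≤ ω)
    (hU : ∀ t v, ‖U.op t v‖ ≤ M * Real.exp (ω * |t|) * ‖v‖)
    (P : ℍ[ℝ][X]) (m : ℕ) (hm : P.natDegree = m) (hP : QuatCalc.IsIntrinsic P)
    (f : ℍ[ℝ] → ℍ[ℝ]) (μ ν : VectorMeasure ℝ ℍ[ℝ])
    (hf : QuatCalc.IsLaplaceStieltjes ω μ f)
    (hPf : QuatCalc.IsLaplaceStieltjes ω ν (fun s => P.eval s * f s)) :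
    (∀ u : V, QuatCalc.funOp U μ u ∈ (QuatCalc.ppow U.generator m).domain) ∧
    ∀ u : V, ∃ h : QuatCalc.funOp U μ u ∈ (QuatCalc.polyOp P U.generator).domain,
      QuatCalc.polyOp P U.generator ⟨QuatCalc.funOp U μ u, h⟩ = QuatCalc.funOp U ν u := by
  obtain ⟨Q, rfl⟩ := hP.exists_map_eq
  rw [natDegree_map] at hm
  obtain ⟨b₁, hb₁, h₁⟩ := hf.exists_hasExpMoment
  obtain ⟨b₂, hb₂, h₂⟩ := hPf.exists_hasExpMoment
  set a := min b₁ b₂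
  have ha : ω < a := lt_min hb₁ hb₂
  have ha0 : 0 < a := hω.trans_lt ha
  obtain ⟨hμ, hfμ⟩ := h₁ a (min_le_left _ _)
  obtain ⟨hν, hfν⟩ := h₂ a (min_le_right _ _)
  have hprod : ∀ s : ℍ[ℝ], |s.re| < a →
      aeval s Q * QuatCalc.leftIntegral μ (fun t => NormedSpace.exp (-(t • s))) =
        QuatCalc.leftIntegral ν (fun t => NormedSpace.exp (-(t • s))) := fun s hs => by
    rw [← hfν s hs, ← hfμ s hs, eval_map_algebraMap]
  -- At a real point P(x) is a real scalar, so the product formula splits into the four coordinates.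
  have hreal : ∀ n, ∀ x : ℝ, |x| < a →
      Q.eval x * QuatCalc.diffIntegral (QuatCalc.componentPair μ n)
        (fun t => Real.exp (-(t * x))) =
        QuatCalc.diffIntegral (QuatCalc.componentPair ν n) (fun t => Real.exp (-(t * x))) := by
    intro n x hx
    have h := hprod (x : ℍ[ℝ]) hx
    have hQx : aeval (x : ℍ[ℝ]) Q = algebraMap ℝ ℍ[ℝ] (Q.eval x) := by
      rw [← coe_aeval_eq_eval, ← aeval_algebraMap_apply]
      rfl
    rw [hQx, ← Algebra.smul_def, QuatCalc.leftIntegral_exp_real hμ hx,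
      QuatCalc.leftIntegral_exp_real hν hx, Finset.smul_sum] at h
    simp only [smul_smul] at h
    rw [QuatCalc.sum_smul_quatUnit, QuatCalc.sum_smul_quatUnit] at h
    fin_cases n
    · exact congrArg QuaternionAlgebra.re h
    · exact congrArg QuaternionAlgebra.imI h
    · exact congrArg QuaternionAlgebra.imJ h
    · exact congrArg QuaternionAlgebra.imK h
  have hsum : ∀ {κ : VectorMeasure ℝ ℍ[ℝ]}, QuatCalc.HasExpMoment a κ.variation → ∀ u : V,
      QuatCalc.funOp U κ u = ∑ n, QuatCalc.quatUnit n •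
        QuatCalc.diffIntegral (QuatCalc.componentPair κ n) (fun t => U.op (-t) u) :=
    fun hκ u => QuatCalc.leftIntegral_eq_sum _
      (QuatCalc.StronglyContinuousGroup.integrable_op_neg hU ha.le hκ u)
  have hone : QuatCalc.quatUnit 0 = 1 := rfl
  have key : ∀ u : V, ∃ z : ℕ → V, z 0 = QuatCalc.funOp U μ u ∧
      (∀ k < m, U.GenTo (z k) (z (k + 1))) ∧
      ∑ k ∈ Finset.range (m + 1), Q.coeff k • z k = QuatCalc.funOp U ν u := by
    intro u
    rcases Nat.eq_zero_or_pos m with hm0 | hmpos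
    -- Degree zero is separate because `μ` need not be real here. A real constant commutes with the
    -- units, so each coordinate is simply scaled.
    · refine ⟨fun _ => QuatCalc.funOp U μ u, rfl, by omega, ?_⟩
      have : SMulCommClass ℝ ℍ[ℝ] V := IsScalarTower.to_smulCommClass
      rw [hm0, zero_add, Finset.sum_range_one, hsum hμ, hsum hν, Finset.smul_sum]
      refine Finset.sum_congr rfl fun n _ => ?_
      rw [smul_comm]
      congr 1
      refine QuatCalc.diffIntegral_eq_smul_of_laplace ha0
        (QuatCalc.componentPair_hasExpMoment hν n) (QuatCalc.componentPair_hasExpMoment hμ n)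
        (fun x hx => ?_) (U.continuous_op_neg u) ha.le
        (QuatCalc.StronglyContinuousGroup.norm_op_neg_le hU u)
      rw [← hreal n x hx, eq_C_of_natDegree_eq_zero (hm.trans hm0)]
      simp
    · have hdeg : Q.natDegree ≠ 0 := by omega
      have hvanμ : ∀ n, n ≠ 0 → QuatCalc.diffIntegral (QuatCalc.componentPair μ n)
          (fun t => U.op (-t) u) = 0 := fun n hn => by
        rw [QuatCalc.diffIntegral,
          QuatCalc.componentPair_fst_eq_snd ha0 hμ hν hdeg hreal hprod hn, sub_self]
      have hvanν : ∀ n, n ≠ 0 → QuatCalc.diffIntegral (QuatCalc.componentPair ν n)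
          (fun t => U.op (-t) u) = 0 := fun n hn => by
        -- The transform of this coordinate of `ν` is P(x) times the zero transform of that of `μ`.
        have h1 : (QuatCalc.componentPair ν n).1 = (QuatCalc.componentPair ν n).2 := by
          refine QuatCalc.fst_eq_snd_of_laplace_eq_zero ha0
            (QuatCalc.componentPair_hasExpMoment hν n) fun x hx => ?_
          rw [← hreal n x hx, QuatCalc.diffIntegral,
            QuatCalc.componentPair_fst_eq_snd ha0 hμ hν hdeg hreal hprod hn, sub_self, mul_zero]
        rw [QuatCalc.diffIntegral, h1, sub_self]
      -- Only the unit 1 survives, so no left multiplication stands between the generator and the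
      -- integrals.
      rw [hsum hμ, hsum hν,
        Finset.sum_eq_single 0 (fun n _ hn => by rw [hvanμ n hn, smul_zero]) (by simp),
        Finset.sum_eq_single 0 (fun n _ hn => by rw [hvanν n hn, smul_zero]) (by simp), hone,
        one_smul, one_smul]
      exact QuatCalc.StronglyContinuousGroup.exists_chain_of_laplace hU hω ha
        (QuatCalc.componentPair_hasExpMoment hμ 0) u m Q _ hm
        (QuatCalc.componentPair_hasExpMoment hν 0) (hreal 0)
  have hpow : ∀ u : V, ∃ z : ℕ → V, (∀ k ≤ m, ∃ h : QuatCalc.funOp U μ u ∈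
      (QuatCalc.ppow U.generator k).domain, QuatCalc.ppow U.generator k ⟨_, h⟩ = z k) ∧
      ∑ k ∈ Finset.range (m + 1), Q.coeff k • z k = QuatCalc.funOp U ν u := by
    intro u
    obtain ⟨z, hz0, hz, hzs⟩ := key u
    refine ⟨z, ?_, hzs⟩
    rw [← hz0]
    exact QuatCalc.ppow_generator_eq_of_chain hz
  refine ⟨fun u => ?_, fun u => ?_⟩
  · obtain ⟨z, hz, -⟩ := hpow u
    exact (hz m le_rfl).1
  · obtain ⟨z, hz, hzs⟩ := hpow u
    subst hm
    obtain ⟨h, hv⟩ := QuatCalc.polyOp_apply_of_ppow hz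
    exact ⟨h, hv.trans hzs⟩
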